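/- Let $a<b$ be real and let $|\cdot|$ be an arbitrary fixed norm on $\mathbb R^d$. For non-empty compact sets $A,B\subset\mathbb R^d$ let $\mathrm{Haus}(A,B)=\max\{\sup_{u\in A}\inf_{v\in B}|u-v|,\ \sup_{v\in B}\inf_{u\in A}|u-v|\}$ be the Hausdorff distance (the same formula is used for arbitrary non-empty subsets), put $|A|=\mathrm{Haus}(A,\{0\})$, and let $\mathcal F$ be the class of maps $F$ from $[a,b]$ to the non-empty compact subsets of $\mathbb R^d$ that are of bounded variation with respect to $\mathrm{Haus}$ and have compact graph $\{(t,y): t\in[a,b],\ y\in F(t)\}$. For $F\in\mathcal F$ put $\|F\|_\infty=\sup_{t\in[a,b]}|F(t)|$ and $v_F(t)=V_a^t(F)$, the variation of $F$ on $[a,t]$. A pair $(u,v)\in A\times B$ is a metric pair of $(A,B)$ if $|u-v|=\mathrm{dist}(v,A)$ or $|u-v|=\mathrm{dist}(u,B)$. A metric chain of $A_0,\dots,A_m$ is a tuple $(y_0,\dots,y_m)$ with $y_i\in A_i$ such that $(y_i,y_{i+1})$ is a metric pair of $(A_i,A_{i+1})$ for $0\le i<m$. For a partition $\chi:\ a=x_0<\dots<x_N=b$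 with norm $|\chi|=\max_i(x_{i+1}-x_i)$ and a metric chain $\phi=(y_0,\dots,y_N)$ of $F(x_0),\dots,F(x_N)$, the chain function $c_{\chi,\phi}$ equals $y_i$ on $[x_i,x_{i+1})$ for $i<N$, and $y_N$ at $b$. A metric selection of $F$ is a function $s:[a,b]\to\mathbb R^d$ with $s(t)\in F(t)$ for all $t$ that is the pointwise limit on $[a,b]$ of chain functions $c_{\chi_k,\phi_k}$ of $F$ with $|\chi_k|\to0$; let $\mathcal S(F)$ be the set of metric selections. For $\kappa:[a,b]\to\mathbb R$, the weighted metric integral $(\mathcal M_\kappa)\int_a^b\kappa(t)F(t)\,dt$ is the set of all limits of convergent sequences $w_k\in S_{\chi_k}$ with $|\chi_k|\to0$, where $S_\chi=\{\sum_{i=0}^{N-1}(x_{i+1}-x_i)\kappa(x_i)y_i:\ (y_0,\dots,y_{N-1})\text{ a metric chain of }F(x_0),\dots,F(x_{N-1})\}$. Let $\mathcal K_n:[a,b]\times[a,b]\to\mathbb R$, $n\in\mathbb N$, be kernels such that $\mathcal K_n(z,\cdot)$ is of bounded variation for every $z\in[a,b]$ and every $n$. For real-valued $f$ put $T_nf(x)=\int_a^b\mathcal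 K_n(x,t)f(t)\,dt$ (when the integral exists), and for $F\in\mathcal F$ let $T_nF(x)$ be the weighted metric integral of $F$ with weight $\kappa=\mathcal K_n(x,\cdot)$. Put $\alpha_n(x)=\left|\int_a^b\mathcal K_n(x,t)\,dt-1\right|$ and $\beta_n(x,\delta)=\int_{t\in[a,b],\,|x-t|\ge\delta}|\mathcal K_n(x,t)|\,dt$, and for each $z\in[a,b]$ let $M(z)\in[0,\infty]$ satisfy $\int_a^b|\mathcal K_n(z,t)|\,dt\le M(z)$ for all $n$. For $x\in(a,b)$ and $\eta>0$ put $$\Omega(v_F,x,\eta)=\max\Big\{\sup_{t\in[x-\eta,x)\cap[a,b]}|v_F(x-)-v_F(t)|,\ \sup_{t\in(x,x+\eta]\cap[a,b]}|v_F(x+)-v_F(t)|\Big\}.$$ For $x\in(a,b)$ let $A_F(x)=\{\tfrac12(s(x+)+s(x-)):\ s\in\mathcal S(F)\}$, and let $\mathrm{sign}(u)$ be $1$, $0$, $-1$ for $u>0$, $u=0$, $u<0$. **Theorem.** Let $F\in\mathcal F$ and $x\in(a,b)$. Then the sets $T_nF(x)$ ($n\in\mathbb N$) and $A_F(x)$ are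 non-empty, and the following hold. (i) For all $\delta>0$ and $n\in\mathbb N$, $$\mathrm{Haus}(T_nF(x),A_F(x))\le 2\,\Omega(v_F,x,2\delta)\,M(x)+\|F\|_\infty\big(4\beta_n(x,\delta)+\alpha_n(x)+|T_n(\mathrm{sign}(\cdot-x))(x)|\big),$$ where $0\cdot\infty=0$. (ii) If $\lim_{n\to\infty}\alpha_n(x)=0$, $\lim_{n\to\infty}\beta_n(x,\delta)=0$ for all sufficiently small $\delta>0$, $\lim_{n\to\infty}T_n(\mathrm{sign}(\cdot-x))(x)=0$, and $M(x)<\infty$, then $\lim_{n\to\infty}\mathrm{Haus}(T_nF(x),A_F(x))=0$. -/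

import Mathlib

open Set Filter Topology MeasureTheory
open scoped ENNReal

noncomputable section

namespace MetricSVF

/-- A partition `a = x₀ < x₁ < ⋯ < xₙ = b` of `[a, b]`. The points are `pts 0, …, pts n`;
the values `pts i` with `i > n` are never used. -/
structure IntervalPartition (a b : ℝ) where
  n : ℕ
  pts : ℕ → ℝ
  lt_succ : ∀ i < n, pts i < pts (i + 1)
  first : pts 0 = a
  last : pts n = b

/-- The norm `|χ| = max_{i < n} (x_{i+1} - x_i)` of a partition. -/
def IntervalPartition.mesh {a b : ℝ} (P : IntervalPartition a b) : ℝ :=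
  ⨆ i : Fin P.n, (P.pts (i + 1) - P.pts i)

theorem IntervalPartition.strictMonoOn {a b : ℝ} (P : IntervalPartition a b) {i j : ℕ}
    (hij : i < j) (hj : j ≤ P.n) : P.pts i < P.pts j := by
  induction j with
  | zero => omega
  | succ k ih =>
    have h1 := P.lt_succ k (by omega)
    rcases Nat.lt_succ_iff_lt_or_eq.mp hij with h | h
    · exact (ih h (by omega)).trans h1
    · exact h ▸ h1

open Classical in
/-- The chain function: it equals `y i` on `[x_i, x_{i+1})` for `i < n`, and `y n` at `x_n = b`
(see `chainFun_of_mem` and `chainFun_last`). -/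
def chainFun {E : Type*} {a b : ℝ} (P : IntervalPartition a b) (y : ℕ → E) (t : ℝ) : E :=
  y (Nat.findGreatest (fun i => P.pts i ≤ t) P.n)

theorem chainFun_of_mem {E : Type*} {a b : ℝ} (P : IntervalPartition a b) (y : ℕ → E) {i : ℕ} (hi : i < P.n)
    {t : ℝ} (ht : t ∈ Ico (P.pts i) (P.pts (i + 1))) : chainFun P y t = y i := by
  classical
  unfold chainFun
  congr 1
  rw [Nat.findGreatest_eq_iff]
  refine ⟨hi.le, fun _ => ht.1, fun j hij hj hle => ?_⟩
  rcases Nat.lt_or_eq_of_le (Nat.succ_le_of_lt hij) with h | h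
  · exact absurd (hle.trans_lt ht.2) (P.strictMonoOn h hj).not_gt
  · subst h
    exact absurd (hle.trans_lt ht.2) (lt_irrefl _)

theorem chainFun_last {E : Type*} {a b : ℝ} (P : IntervalPartition a b) (y : ℕ → E) :
    chainFun P y b = y P.n := by
  classical
  unfold chainFun
  congr 1
  rw [Nat.findGreatest_eq_iff]
  exact ⟨le_rfl, fun _ => P.last.le, fun j h1 h2 => absurd h1 (by omega)⟩

section Sets

variable {E : Type*} [NormedAddCommGroup E]

/-- The set of projections of the point `c` on the set `B`. -/
def projSet (c : E) (B : Set E) : Set E := {p | p ∈ B ∧ dist c p = Metric.infDist c B}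

/-- The set of metric pairs of two sets. -/
def metricPairs (A B : Set E) : Set (E × E) :=
  {p | p.1 ∈ A ∧ p.2 ∈ B ∧ (p.1 ∈ projSet p.2 A ∨ p.2 ∈ projSet p.1 B)}

/-- `(y 0, …, y (m - 1))` is a metric chain of the `m` sets `A 0, …, A (m - 1)`. -/
def IsMetricChain (A : ℕ → Set E) (m : ℕ) (y : ℕ → E) : Prop :=
  (∀ i < m, y i ∈ A i) ∧ ∀ i, i + 1 < m → (y i, y (i + 1)) ∈ metricPairs (A i) (A (i + 1))

/-- The set-valued function `F` belongs to the class `𝓕` on `[a, b]`: it is of bounded variation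
with respect to the Hausdorff metric and its graph is compact. -/
def ClassF (a b : ℝ) (F : ℝ → TopologicalSpace.NonemptyCompacts E) : Prop :=
  BoundedVariationOn F (Icc a b) ∧
    IsCompact {p : ℝ × E | p.1 ∈ Icc a b ∧ p.2 ∈ F p.1}

/-- `s` (restricted to `[a, b]`) is a metric selection of `F`. -/
def IsMetricSelection (a b : ℝ) (F : ℝ → TopologicalSpace.NonemptyCompacts E) (s : ℝ → E) :
    Prop :=
  (∀ t ∈ Icc a b, s t ∈ F t) ∧
    ∃ (P : ℕ → IntervalPartition a b) (y : ℕ → ℕ → E),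
      (∀ k, IsMetricChain (fun i => (F ((P k).pts i) : Set E)) ((P k).n + 1) (y k)) ∧
      Tendsto (fun k => (P k).mesh) atTop (𝓝 0) ∧
      ∀ t ∈ Icc a b, Tendsto (fun k => chainFun (P k) (y k) t) atTop (𝓝 (s t))

/-- The weighted metric Riemann sum of `F` for the weight `κ` and the partition `P`: all sums
`∑_{i<n} (x_{i+1} - x_i) κ(x_i) y_i` over metric chains `(y_0, …, y_{n-1})` of
`F(x_0), …, F(x_{n-1})`. -/
def weightedRiemannSum [NormedSpace ℝ E] {a b : ℝ} (κ : ℝ → ℝ) (F : ℝ → TopologicalSpace.NonemptyCompacts E)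
    (P : IntervalPartition a b) : Set E :=
  {z | ∃ y : ℕ → E, IsMetricChain (fun i => (F (P.pts i) : Set E)) P.n y ∧
    z = ∑ i ∈ Finset.range P.n, ((P.pts (i + 1) - P.pts i) * κ (P.pts i)) • y i}

/-- The weighted metric integral of `F` over `[a, b]` with weight `κ`: the upper Kuratowski limit
of the weighted metric Riemann sums as the norm of the partition tends to `0`. -/
def weightedMetricIntegral [NormedSpace ℝ E] (a b : ℝ) (κ : ℝ → ℝ)
    (F : ℝ → TopologicalSpace.NonemptyCompacts E) : Set E :=
  {z | ∃ (P : ℕ → IntervalPartition a b) (w : ℕ → E),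
    Tendsto (fun k => (P k).mesh) atTop (𝓝 0) ∧
    (∀ k, w k ∈ weightedRiemannSum κ F (P k)) ∧ Tendsto w atTop (𝓝 z)}

/-- The metric integral operator `T_n F (x)` with kernels `K n x t`. -/
def metricIntegralOp [NormedSpace ℝ E] (a b : ℝ) (K : ℕ → ℝ → ℝ → ℝ)
    (F : ℝ → TopologicalSpace.NonemptyCompacts E) (n : ℕ) (x : ℝ) : Set E :=
  weightedMetricIntegral a b (fun t => K n x t) F

/-- `A_F(x) = {(s(x+) + s(x-)) / 2 : s a metric selection of F}`. -/
def midpointSet [NormedSpace ℝ E] (a b : ℝ) (F : ℝ → TopologicalSpace.NonemptyCompacts E) (x : ℝ) : Set E :=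
  {z | ∃ s : ℝ → E, IsMetricSelection a b F s ∧
    z = (1 / 2 : ℝ) • (Function.rightLim s x + Function.leftLim s x)}

/-- `‖F‖_∞ = sup_{t ∈ [a, b]} |F(t)|`, where `|A|` is the Hausdorff distance of `A` to `{0}`. -/
def supNorm (a b : ℝ) (F : ℝ → TopologicalSpace.NonemptyCompacts E) : ℝ :=
  ⨆ t : Icc a b, Metric.hausdorffDist (F t : Set E) {0}

/-- The variation function `v_F(t) = V_a^t(F)`. -/
def variationFun (a : ℝ) (F : ℝ → TopologicalSpace.NonemptyCompacts E) (t : ℝ) : ℝ :=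
  (eVariationOn F (Icc a t)).toReal

end Sets

/-- The left local quasi-modulus at `x` of a function on `[a, b]`. -/
def leftQuasiModulus {X : Type*} [MetricSpace X] (a b : ℝ) (f : ℝ → X) (x δ : ℝ) : ℝ :=
  sSup ((fun t => dist (Function.leftLim f x) (f t)) '' (Ico (x - δ) x ∩ Icc a b))

/-- The right local quasi-modulus at `x` of a function on `[a, b]`. -/
def rightQuasiModulus {X : Type*} [MetricSpace X] (a b : ℝ) (f : ℝ → X) (x δ : ℝ) : ℝ :=
  sSup ((fun t => dist (Function.rightLim f x) (f t)) '' (Ioc x (x + δ) ∩ Icc a b))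

/-- The local quasi-modulus at `x`: the larger of the two one-sided ones. -/
def quasiModulus {X : Type*} [MetricSpace X] (a b : ℝ) (f : ℝ → X) (x δ : ℝ) : ℝ :=
  max (leftQuasiModulus a b f x δ) (rightQuasiModulus a b f x δ)

/-- The integral operator `T_n f (x) = ∫_a^b K_n(x, t) f(t) dt` on real functions. -/
def integralOp (a b : ℝ) (K : ℕ → ℝ → ℝ → ℝ) (n : ℕ) (f : ℝ → ℝ) (x : ℝ) : ℝ :=
  ∫ t in Icc a b, K n x t * f t

/-- `α_n(x) = |∫_a^b K_n(x, t) dt - 1|`. -/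
def alpha (a b : ℝ) (K : ℕ → ℝ → ℝ → ℝ) (n : ℕ) (x : ℝ) : ℝ :=
  |(∫ t in Icc a b, K n x t) - 1|

/-- `β_n(x, δ)` is the integral of `|K_n(x, t)|` over those `t ∈ [a, b]` with `|x - t| ≥ δ`. -/
def beta (a b : ℝ) (K : ℕ → ℝ → ℝ → ℝ) (n : ℕ) (x δ : ℝ) : ℝ :=
  ∫ t in Icc a b ∩ {t | δ ≤ |x - t|}, |K n x t|

end MetricSVF

end

/-! Everything reduces to single metric selections. Consecutive points of a metric chain are no
farther apart than the corresponding values of `F` in the Hausdorff metric, so the variation of a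
chain is controlled by `v_F`. This gives a Helly principle: chain functions with mesh tending to `0`
have a subsequence converging pointwise to a metric selection
(`exists_subseq_tendsto_isMetricSelection`). A weighted Riemann sum is the integral of a step
function, so dominated convergence identifies the weighted metric integral with the set of integrals
`∫ κ s`, with `s` ranging over the metric selections (`mem_weightedMetricIntegral_iff`).

Hence `T_n F(x)` and `A_F(x)` are parametrized by the same family of selections, and a bound for
each `s`, uniform in `s`, bounds the Hausdorff distance. Let `m` be the mean of `s(x+)` and `s(x-)`,
and `h` half their difference. Away from `x`, the function `m + sign(t - x) h` equals the one-sided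
limit of `s` on the side of `t`. Thus `∫ κ s - m = ∫ κ (s - m - sign(t - x) h) + (∫ κ - 1) m + (∫ κ
sign(t - x)) h`. Within `δ` of `x` the bracket is at most the quasi-modulus of `v_F`; elsewhere it
is at most `2 ‖F‖_∞`, which produces the `β` term (`norm_integral_sub_midpoint_le`). Convergence
follows because the quasi-modulus of a monotone function vanishes at `0+`. -/

namespace MetricSVF

/-! ### Partitions and the node to the left of a point. -/

open Classical in
/-- The index of the last partition point that is at most `t`. -/
noncomputable def IntervalPartition.idx {a b : ℝ} (P : IntervalPartition a b) (t : ℝ) : ℕ :=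
  Nat.findGreatest (fun i => P.pts i ≤ t) P.n

namespace IntervalPartition

variable {a b : ℝ} (P : IntervalPartition a b)

theorem idx_le (t : ℝ) : P.idx t ≤ P.n := Nat.findGreatest_le _

theorem idx_mono : Monotone P.idx := fun _ _ h =>
  Nat.findGreatest_mono_left (fun _ hi => le_trans hi h) _

theorem pts_idx_le {t : ℝ} (ht : a ≤ t) : P.pts (P.idx t) ≤ t := by
  classical
  exact Nat.findGreatest_spec (P := fun i => P.pts i ≤ t) (Nat.zero_le _) (P.first.trans_le ht)

theorem lt_pts_idx_succ {t : ℝ} (h : P.idx t < P.n) : t < P.pts (P.idx t + 1) := by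
  classical
  exact not_le.1 (Nat.findGreatest_is_greatest (P := fun i => P.pts i ≤ t)
    (Nat.lt_succ_self _) h)

theorem monotoneOn {i j : ℕ} (hij : i ≤ j) (hj : j ≤ P.n) : P.pts i ≤ P.pts j := by
  rcases hij.lt_or_eq with h | rfl
  · exact (P.strictMonoOn h hj).le
  · exact le_rfl

theorem pts_mem {i : ℕ} (hi : i ≤ P.n) : P.pts i ∈ Icc a b :=
  ⟨P.first.ge.trans (P.monotoneOn (Nat.zero_le i) hi), by simpa [P.last] using P.monotoneOn hi le_rfl⟩

theorem pts_idx_mem (t : ℝ) : P.pts (P.idx t) ∈ Icc a b := P.pts_mem (P.idx_le t)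

theorem sub_le_mesh {i : ℕ} (hi : i < P.n) : P.pts (i + 1) - P.pts i ≤ P.mesh :=
  le_ciSup (f := fun i : Fin P.n => P.pts (i + 1) - P.pts i) (finite_range _).bddAbove ⟨i, hi⟩

theorem mesh_nonneg : 0 ≤ P.mesh :=
  Real.iSup_nonneg fun i => sub_nonneg.2 (P.lt_succ i i.2).le

theorem sub_mesh_le {t : ℝ} (ht : t ≤ b) : t - P.mesh ≤ P.pts (P.idx t) := by
  rcases (P.idx_le t).lt_or_eq with h | h
  · linarith [P.lt_pts_idx_succ h, P.sub_le_mesh h]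
  · rw [h, P.last]
    linarith [P.mesh_nonneg]

theorem tendsto_pts_idx {P : ℕ → IntervalPartition a b}
    (hP : Tendsto (fun k => (P k).mesh) atTop (𝓝 0)) {t : ℝ} (ht : t ∈ Icc a b) :
    Tendsto (fun k => (P k).pts ((P k).idx t)) atTop (𝓝 t) := by
  refine tendsto_of_tendsto_of_tendsto_of_le_of_le (g := fun k => t - (P k).mesh) ?_
    tendsto_const_nhds (fun k => (P k).sub_mesh_le ht.2) fun k => (P k).pts_idx_le ht.1
  simpa using tendsto_const_nhds.sub hP

theorem measurable_idx : Measurable P.idx := by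
  classical
  exact measurable_findGreatest fun k _ => measurableSet_Ici

/-- The uniform partition into `k + 1` intervals. -/
noncomputable def uniform (h : a < b) (k : ℕ) : IntervalPartition a b where
  n := k + 1
  pts i := a + i * ((b - a) / (k + 1))
  lt_succ i _ := by
    have : 0 < (b - a) / (k + 1) := div_pos (sub_pos.2 h) (by positivity)
    push_cast
    linarith
  first := by simp
  last := by
    push_cast
    field_simp
    ring

theorem tendsto_mesh_uniform (h : a < b) :
    Tendsto (fun k => (uniform h k).mesh) atTop (𝓝 0) := by
  have h1 : ∀ k, (uniform h k).mesh = (b - a) * (1 / ((k : ℝ) + 1)) := fun k => by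
    have : Nonempty (Fin (uniform h k).n) := ⟨⟨0, Nat.succ_pos k⟩⟩
    have h2 : ∀ i : Fin (uniform h k).n, (uniform h k).pts (i + 1) - (uniform h k).pts i =
        (b - a) * (1 / ((k : ℝ) + 1)) := fun i => by
      simp only [uniform]
      push_cast
      ring
    simp only [mesh, h2, ciSup_const]
  simp only [h1]
  simpa using tendsto_one_div_add_atTop_nhds_zero_nat.const_mul (b - a)

end IntervalPartition

/-! ### Metric chains, their variation, and Helly selection. -/

section

variable {E : Type*} [NormedAddCommGroup E] {a b : ℝ}
  {F : ℝ → TopologicalSpace.NonemptyCompacts E}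

theorem dist_le_variationFun_sub (hF : BoundedVariationOn F (Icc a b)) {r t : ℝ} (har : a ≤ r)
    (hrt : r ≤ t) (htb : t ≤ b) :
    dist (F r) (F t) ≤ variationFun a F t - variationFun a F r := by
  have hfin : ∀ c d, a ≤ c → d ≤ b → eVariationOn F (Icc c d) ≠ ⊤ := fun c d hc hd =>
    hF.mono (Icc_subset_Icc hc hd)
  have h := eVariationOn.Icc_add_Icc F (s := univ) har hrt (mem_univ r)
  simp only [univ_inter] at h
  have h2 := congrArg ENNReal.toReal h
  rw [ENNReal.toReal_add (hfin _ _ le_rfl (hrt.trans htb)) (hfin _ _ har htb)] at h2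
  have h3 := BoundedVariationOn.dist_le (hfin _ _ har htb : BoundedVariationOn F (Icc r t))
    (left_mem_Icc.2 hrt) (right_mem_Icc.2 hrt)
  simp only [variationFun]
  linarith

theorem variationFun_monotoneOn (hF : BoundedVariationOn F (Icc a b)) :
    MonotoneOn (variationFun a F) (Icc a b) := fun r hr t ht hrt => by
  linarith [dist_le_variationFun_sub hF hr.1 hrt ht.2, dist_nonneg (x := F r) (y := F t)]

/-- One of the two points realizes the distance from the other to its set, and such a distance never
exceeds the Hausdorff distance. -/
theorem dist_le_of_mem_metricPairs {A B : TopologicalSpace.NonemptyCompacts E} {u v : E}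
    (h : (u, v) ∈ metricPairs (A : Set E) B) : dist u v ≤ dist A B := by
  have fin : Metric.hausdorffEDist (A : Set E) B ≠ ⊤ :=
    Metric.hausdorffEDist_ne_top_of_nonempty_of_bounded A.nonempty B.nonempty
      A.isCompact.isBounded B.isCompact.isBounded
  obtain ⟨hu, hv, h | h⟩ := h
  · rw [dist_comm, h.2, dist_comm, Metric.NonemptyCompacts.dist_eq]
    exact Metric.infDist_le_hausdorffDist_of_mem hv (by rwa [Metric.hausdorffEDist_comm])
  · rw [h.2, Metric.NonemptyCompacts.dist_eq]
    exact Metric.infDist_le_hausdorffDist_of_mem hu fin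

theorem exists_mem_metricPairs (A B : TopologicalSpace.NonemptyCompacts E) {u : E} (hu : u ∈ A) :
    ∃ v, (u, v) ∈ metricPairs (A : Set E) B := by
  obtain ⟨v, hv, h⟩ := B.isCompact.exists_infDist_eq_dist B.nonempty u
  exact ⟨v, hu, hv, Or.inr ⟨hv, h.symm⟩⟩

theorem exists_isMetricChain (A : ℕ → TopologicalSpace.NonemptyCompacts E) (m : ℕ) :
    ∃ y, IsMetricChain (fun i => (A i : Set E)) m y := by
  choose f hf using fun i (u : A i) => exists_mem_metricPairs (A i) (A (i + 1)) u.2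
  let z : ∀ i, A i := fun i => Nat.rec (motive := fun i => A i)
    ⟨(A 0).nonempty.some, (A 0).nonempty.some_mem⟩ (fun i u => ⟨f i u, (hf i u).2.1⟩) i
  exact ⟨fun i => z i, fun i _ => (z i).2, fun i _ => hf i (z i)⟩

/-- Riemann sums use chains without a point over `b`, while chain functions need one. Projecting the
last point supplies it. -/
theorem IsMetricChain.exists_extend {A : ℕ → TopologicalSpace.NonemptyCompacts E} {m : ℕ}
    {y : ℕ → E} (h : IsMetricChain (fun i => (A i : Set E)) m y) (hm : 0 < m) :
    ∃ y', IsMetricChain (fun i => (A i : Set E)) (m + 1) y' ∧ ∀ i < m, y' i = y i := by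
  obtain ⟨m, rfl⟩ : ∃ k, m = k + 1 := ⟨m - 1, by omega⟩
  obtain ⟨v, hv⟩ := exists_mem_metricPairs (A m) (A (m + 1)) (h.1 m (by omega))
  have e : ∀ i < m + 1, Function.update y (m + 1) v i = y i := fun i hi =>
    Function.update_of_ne hi.ne _ _
  refine ⟨Function.update y (m + 1) v, ⟨fun i hi => ?_, fun i hi => ?_⟩, e⟩
  · rcases Nat.lt_succ_iff_lt_or_eq.1 hi with h' | rfl
    · rw [e i h']
      exact h.1 i h'
    · simpa using hv.2.1
  · rcases Nat.lt_succ_iff_lt_or_eq.1 hi with h' | h'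
    · rw [e i (by omega), e _ h']
      exact h.2 i h'
    · obtain rfl : i = m := by omega
      rw [e i (by omega), Function.update_self]
      exact hv

/-- Telescoping: each step of the chain is at most the increment of `v_F` between neighbouring
nodes. -/
theorem IsMetricChain.dist_le (hF : BoundedVariationOn F (Icc a b)) {P : IntervalPartition a b}
    {y : ℕ → E} (h : IsMetricChain (fun i => (F (P.pts i) : Set E)) (P.n + 1) y) {i j : ℕ}
    (hij : i ≤ j) (hj : j ≤ P.n) :
    dist (y i) (y j) ≤ variationFun a F (P.pts j) - variationFun a F (P.pts i) := by
  induction j, hij using Nat.le_induction with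
  | base => simp
  | succ j hij ih =>
    have h1 := dist_le_variationFun_sub hF (P.pts_mem (i := j) (by omega)).1
      (P.lt_succ j (by omega)).le (P.pts_mem hj).2
    have h2 := dist_le_of_mem_metricPairs (h.2 j (by omega))
    linarith [ih (by omega), dist_triangle (y i) (y j) (y (j + 1))]

theorem IsMetricChain.dist_chainFun_le (hF : BoundedVariationOn F (Icc a b))
    {P : IntervalPartition a b} {y : ℕ → E}
    (h : IsMetricChain (fun i => (F (P.pts i) : Set E)) (P.n + 1) y) {t t' : ℝ} (htt : t ≤ t') :
    dist (chainFun P y t) (chainFun P y t') ≤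
      variationFun a F (P.pts (P.idx t')) - variationFun a F (P.pts (P.idx t)) :=
  h.dist_le hF (P.idx_mono htt) (P.idx_le t')

theorem IsMetricChain.chainFun_mem {P : IntervalPartition a b} {y : ℕ → E}
    (h : IsMetricChain (fun i => (F (P.pts i) : Set E)) (P.n + 1) y) (t : ℝ) :
    chainFun P y t ∈ F (P.pts (P.idx t)) :=
  h.1 _ (Nat.lt_succ_of_le (P.idx_le t))

theorem norm_le_supNorm (hF : ClassF a b F) {t : ℝ} (ht : t ∈ Icc a b) {u : E} (hu : u ∈ F t) :
    ‖u‖ ≤ supNorm a b F := by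
  obtain ⟨R, hR⟩ := (hF.2.image continuous_snd).isBounded.exists_norm_le
  have hR' : ∀ s ∈ Icc a b, ∀ w ∈ F s, ‖w‖ ≤ R := fun s hs w hw =>
    hR w ⟨(s, w), ⟨hs, hw⟩, rfl⟩
  have h1 : BddAbove (range fun t : Icc a b => Metric.hausdorffDist (F t : Set E) {0}) := by
    refine ⟨R, ?_⟩
    rintro _ ⟨s, rfl⟩
    obtain ⟨w, hw⟩ := (F s).nonempty
    refine Metric.hausdorffDist_le_of_mem_dist ((norm_nonneg w).trans (hR' s s.2 w hw))
      (fun v hv => ⟨0, rfl, by simpa using hR' s s.2 v hv⟩) fun v hv => ⟨w, hw, ?_⟩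
    rw [mem_singleton_iff.1 hv]
    simpa using hR' s s.2 w hw
  refine le_trans ?_ (le_ciSup h1 ⟨t, ht⟩)
  have h2 := Metric.infDist_le_hausdorffDist_of_mem (s := (F t : Set E)) (t := {(0 : E)}) hu
    (Metric.hausdorffEDist_ne_top_of_nonempty_of_bounded (F t).nonempty (singleton_nonempty _)
      (F t).isCompact.isBounded Bornology.isBounded_singleton)
  simpa using h2

theorem IsMetricChain.norm_chainFun_le (hF : ClassF a b F) {P : IntervalPartition a b}
    {y : ℕ → E} (h : IsMetricChain (fun i => (F (P.pts i) : Set E)) (P.n + 1) y) (t : ℝ) :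
    ‖chainFun P y t‖ ≤ supNorm a b F :=
  norm_le_supNorm hF (P.pts_idx_mem t) (h.chainFun_mem t)

/-- A Helly selection principle: sequences of chain functions of `F` subconverge pointwise to
metric selections. -/
theorem exists_subseq_tendsto_isMetricSelection [ProperSpace E] (hF : ClassF a b F)
    {P : ℕ → IntervalPartition a b} {y : ℕ → ℕ → E}
    (hy : ∀ k, IsMetricChain (fun i => (F ((P k).pts i) : Set E)) ((P k).n + 1) (y k))
    (hP : Tendsto (fun k => (P k).mesh) atTop (𝓝 0)) :
    ∃ (φ : ℕ → ℕ) (s : ℝ → E), StrictMono φ ∧ IsMetricSelection a b F s ∧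
      ∀ t ∈ Icc a b, Tendsto (fun k => chainFun (P (φ k)) (y (φ k)) t) atTop (𝓝 (s t)) := by
  set v := variationFun a F with hv
  have hmono : MonotoneOn v (Icc a b) := variationFun_monotoneOn hF.1
  -- A diagonal subsequence handles this countable set. The rationals give density; `a` and the
  -- discontinuities of `v_F` are included because the argument at other points needs room on the
  -- left and continuity of `v_F`.
  let D : Set ℝ := {a} ∪ {t | t ∈ Icc a b ∧ ¬ ContinuousWithinAt v (Icc a b) t} ∪
    range ((↑) : ℚ → ℝ)
  have hD : D.Countable := ((countable_singleton a).union
    hmono.countable_not_continuousWithinAt).union (countable_range _)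
  have : Countable D := hD.to_subtype
  obtain ⟨g, -, φ, hφ, hg⟩ := (isCompact_univ_pi fun _ : D =>
    isCompact_closedBall (0 : E) (supNorm a b F)).tendsto_subseq
    (x := fun k (d : D) => chainFun (P k) (y k) d)
    (fun k d _ => by simpa using (hy k).norm_chainFun_le hF d)
  have hPφ := hP.comp hφ.tendsto_atTop
  have hlim : ∀ t ∈ Icc a b, ∃ l, Tendsto (fun k => chainFun (P (φ k)) (y (φ k)) t) atTop (𝓝 l) := by
    intro t ht
    by_cases htD : t ∈ D
    · exact ⟨_, (tendsto_pi_nhds.1 hg) ⟨t, htD⟩⟩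
    refine cauchySeq_tendsto_of_complete (Metric.cauchySeq_iff.2 fun ε hε => ?_)
    simp only [D, mem_union, mem_singleton_iff, mem_ofPred_eq, not_or, not_and, not_not] at htD
    have hat : a < t := lt_of_le_of_ne ht.1 (Ne.symm htD.1.1)
    -- Take `r < q < t` with `q` rational and `v_F(t) - v_F(r) < ε / 3`. Once the node below `q` has
    -- passed `r`, the chain values at `q` and `t` differ by less than `ε / 3`, so the Cauchy
    -- property moves from `q` to `t`.
    obtain ⟨η, hη, hηv⟩ := Metric.continuousWithinAt_iff.1 (htD.1.2 ht) (ε / 3) (by positivity)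
    obtain ⟨r, hr1, hr2⟩ := exists_between (max_lt hat (sub_lt_self t hη))
    have har : a < r := (le_max_left _ _).trans_lt hr1
    have hvr := hηv (x := r) ⟨har.le, (hr2.trans_le ht.2).le⟩ (by
      rw [Real.dist_eq, abs_lt]
      constructor <;> linarith [(le_max_right _ _).trans_lt hr1])
    rw [Real.dist_eq, abs_lt] at hvr
    obtain ⟨q, hq1, hq2⟩ := exists_rat_btwn hr2
    have hqm : (q : ℝ) ∈ Icc a b := ⟨(har.trans hq1).le, (hq2.trans_le ht.2).le⟩
    have hqD : (q : ℝ) ∈ D := Or.inr ⟨q, rfl⟩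
    have hc : CauchySeq fun k => chainFun (P (φ k)) (y (φ k)) q :=
      ((tendsto_pi_nhds.1 hg) ⟨q, hqD⟩).cauchySeq
    obtain ⟨N1, hN1⟩ := Metric.cauchySeq_iff.1 hc (ε / 3) (by positivity)
    obtain ⟨N2, hN2⟩ := eventually_atTop.1
      ((IntervalPartition.tendsto_pts_idx hPφ hqm).eventually (lt_mem_nhds hq1))
    have key : ∀ k ≥ N2, dist (chainFun (P (φ k)) (y (φ k)) q) (chainFun (P (φ k)) (y (φ k)) t)
        < ε / 3 := fun k hk => by
      have h1 := (hy (φ k)).dist_chainFun_le hF.1 hq2.le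
      have h2 := hmono ((P (φ k)).pts_idx_mem t) ht ((P (φ k)).pts_idx_le ht.1)
      have h3 := hmono ⟨har.le, (hr2.trans_le ht.2).le⟩ ((P (φ k)).pts_idx_mem q) (hN2 k hk).le
      linarith
    refine ⟨max N1 N2, fun m hm n hn => ?_⟩
    have h1 := key m (le_of_max_le_right hm)
    have h2 := key n (le_of_max_le_right hn)
    have h3 := hN1 m (le_of_max_le_left hm) n (le_of_max_le_left hn)
    rw [dist_comm] at h1
    linarith [dist_triangle4 (chainFun (P (φ m)) (y (φ m)) t) (chainFun (P (φ m)) (y (φ m)) q)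
      (chainFun (P (φ n)) (y (φ n)) q) (chainFun (P (φ n)) (y (φ n)) t)]
  choose! s hs using hlim
  refine ⟨φ, s, hφ, ⟨fun t ht => ?_, fun k => P (φ k), fun k => y (φ k), fun k => hy (φ k),
    hPφ, hs⟩, hs⟩
  -- The pairs of node and chain value lie in the closed graph of `F`, so their limit does too.
  exact (hF.2.isClosed.mem_of_tendsto
    ((IntervalPartition.tendsto_pts_idx hPφ ht).prodMk_nhds (hs t ht))
    (Eventually.of_forall fun k => ⟨(P (φ k)).pts_idx_mem t, (hy (φ k)).chainFun_mem t⟩)).2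

theorem exists_isMetricSelection [ProperSpace E] (hF : ClassF a b F) (hab : a < b) :
    ∃ s, IsMetricSelection a b F s := by
  choose y hy using fun k => exists_isMetricChain
    (fun i => F ((IntervalPartition.uniform hab k).pts i)) ((IntervalPartition.uniform hab k).n + 1)
  obtain ⟨-, s, -, hs, -⟩ := exists_subseq_tendsto_isMetricSelection hF hy
    (IntervalPartition.tendsto_mesh_uniform hab)
  exact ⟨s, hs⟩

theorem IsMetricSelection.norm_le (hF : ClassF a b F) {s : ℝ → E} (hs : IsMetricSelection a b F s)
    {t : ℝ} (ht : t ∈ Icc a b) : ‖s t‖ ≤ supNorm a b F :=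
  norm_le_supNorm hF ht (hs.1 t ht)

/-- The slack `r < t` is needed because a chain function at `t` takes its value at a node possibly
left of `t`, and `v_F` may jump at `t`. At `r = a` no node lies further left. -/
theorem IsMetricSelection.dist_le (hF : BoundedVariationOn F (Icc a b)) {s : ℝ → E}
    (hs : IsMetricSelection a b F s) {r t t' : ℝ} (hr : a ≤ r) (hrt : r < t ∨ r = a)
    (ht : t ∈ Icc a b) (htt : t ≤ t') (ht' : t' ≤ b) :
    dist (s t) (s t') ≤ variationFun a F t' - variationFun a F r := by
  obtain ⟨-, P, y, hy, hP, hlim⟩ := hs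
  have ht'm : t' ∈ Icc a b := ⟨ht.1.trans htt, ht'⟩
  refine le_of_tendsto ((hlim t ht).dist (hlim t' ht'm)) ?_
  have hrb : r ≤ b := by
    rcases hrt with h | h
    · exact h.le.trans ht.2
    · exact h ▸ ht.1.trans ht.2
  have h0 : ∀ᶠ k in atTop, r ≤ (P k).pts ((P k).idx t) := by
    rcases hrt with h | rfl
    · filter_upwards [(IntervalPartition.tendsto_pts_idx hP ht).eventually (lt_mem_nhds h)] with k hk
      exact hk.le
    · exact Eventually.of_forall fun k => ((P k).pts_idx_mem t).1
  filter_upwards [h0] with k hk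
  have h1 := (hy k).dist_chainFun_le hF htt
  have h2 := variationFun_monotoneOn hF ((P k).pts_idx_mem t') ht'm ((P k).pts_idx_le ht'm.1)
  have h3 := variationFun_monotoneOn hF ⟨hr, hrb⟩ ((P k).pts_idx_mem t) hk
  linarith

end

/-! ### Step functions as integrands, measurability, and weights of bounded variation. -/

section

variable {E : Type*} [NormedAddCommGroup E] {a b : ℝ}
  {F : ℝ → TopologicalSpace.NonemptyCompacts E}

theorem IntervalPartition.stronglyMeasurable_comp_idx (P : IntervalPartition a b) (z : ℕ → E) :
    StronglyMeasurable fun t => z (P.idx t) :=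
  (continuous_of_discreteTopology (f := z)).stronglyMeasurable.comp_measurable P.measurable_idx

theorem IntervalPartition.integral_comp_idx [NormedSpace ℝ E] [CompleteSpace E] (P : IntervalPartition a b)
    (z : ℕ → E) :
    ∫ t in Icc a b, z (P.idx t) =
      ∑ i ∈ Finset.range P.n, (P.pts (i + 1) - P.pts i) • z i := by
  have hidx : ∀ i < P.n, EqOn (fun t => z (P.idx t)) (fun _ => z i)
      (Ico (P.pts i) (P.pts (i + 1))) := fun i hi t ht => chainFun_of_mem P z hi ht
  have hae : ∀ i < P.n, ∀ᵐ t, t ∈ uIoc (P.pts i) (P.pts (i + 1)) → z (P.idx t) = z i := by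
    intro i hi
    filter_upwards [Measure.ae_ne volume (P.pts (i + 1))] with t ht htm
    rw [uIoc_of_le (P.lt_succ i hi).le] at htm
    exact hidx i hi ⟨htm.1.le, lt_of_le_of_ne htm.2 ht⟩
  have hab : a ≤ b := (P.pts_mem (Nat.zero_le _)).1.trans (P.pts_mem (Nat.zero_le _)).2
  rw [integral_Icc_eq_integral_Ioc, ← intervalIntegral.integral_of_le hab]
  have hint : ∀ i < P.n, IntervalIntegrable (fun t => z (P.idx t)) volume (P.pts i)
      (P.pts (i + 1)) := by
    intro i hi
    refine (intervalIntegrable_const (c := z i)).congr_ae ?_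
    rw [EventuallyEq, ae_restrict_iff' measurableSet_uIoc]
    filter_upwards [hae i hi] with t ht htm
    exact (ht htm).symm
  have h := intervalIntegral.sum_integral_adjacent_intervals hint
  rw [P.first, P.last] at h
  rw [← h]
  refine Finset.sum_congr rfl fun i hi => ?_
  rw [intervalIntegral.integral_congr_ae (hae i (Finset.mem_range.1 hi))]
  simp

theorem IsMetricChain.of_le {A : ℕ → Set E} {m n : ℕ} {y : ℕ → E} (h : IsMetricChain A n y)
    (hmn : m ≤ n) : IsMetricChain A m y :=
  ⟨fun i hi => h.1 i (hi.trans_le hmn), fun i hi => h.2 i (hi.trans_le hmn)⟩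

theorem IsMetricSelection.aestronglyMeasurable {s : ℝ → E} (hs : IsMetricSelection a b F s) :
    AEStronglyMeasurable s (volume.restrict (Icc a b)) := by
  obtain ⟨-, P, y, -, -, hlim⟩ := hs
  exact aestronglyMeasurable_of_tendsto_ae atTop
    (fun k => ((P k).stronglyMeasurable_comp_idx (y k)).aestronglyMeasurable)
    ((ae_restrict_iff' measurableSet_Icc).2 (Eventually.of_forall hlim))

end

theorem integrableOn_of_boundedVariationOn {κ : ℝ → ℝ} {a b : ℝ}
    (hκ : BoundedVariationOn κ (Icc a b)) : IntegrableOn κ (Icc a b) := by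
  obtain ⟨p, q, hp, hq, rfl⟩ := hκ.locallyBoundedVariationOn.exists_monotoneOn_sub_monotoneOn
  exact (hp.integrableOn_isCompact isCompact_Icc).sub (hq.integrableOn_isCompact isCompact_Icc)

theorem ae_continuousWithinAt_of_boundedVariationOn {κ : ℝ → ℝ} {a b : ℝ}
    (hκ : BoundedVariationOn κ (Icc a b)) :
    ∀ᵐ t, t ∈ Icc a b → ContinuousWithinAt κ (Icc a b) t := by
  obtain ⟨p, q, hp, hq, rfl⟩ := hκ.locallyBoundedVariationOn.exists_monotoneOn_sub_monotoneOn
  filter_upwards [hp.countable_not_continuousWithinAt.ae_notMem volume,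
    hq.countable_not_continuousWithinAt.ae_notMem volume] with t h1 h2 ht
  simp only [not_and, not_not] at h1 h2
  exact (h1 ht).sub (h2 ht)

/-! ### The weighted metric integral through metric selections. -/

section

variable {E : Type*} [NormedAddCommGroup E] [NormedSpace ℝ E] {a b : ℝ}
  {F : ℝ → TopologicalSpace.NonemptyCompacts E} {κ : ℝ → ℝ}

/-- The sums are integrals of step functions that sample `κ` at the node below `t`. They converge
wherever `κ` is continuous, hence almost everywhere, and are uniformly bounded, so dominated
convergence applies. -/
theorem tendsto_weightedSum [CompleteSpace E] (hF : ClassF a b F) (hκ : BoundedVariationOn κ (Icc a b))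
    {P : ℕ → IntervalPartition a b} {y : ℕ → ℕ → E} {s : ℝ → E}
    (hy : ∀ k, IsMetricChain (fun i => (F ((P k).pts i) : Set E)) ((P k).n + 1) (y k))
    (hP : Tendsto (fun k => (P k).mesh) atTop (𝓝 0))
    (hs : ∀ t ∈ Icc a b, Tendsto (fun k => chainFun (P k) (y k) t) atTop (𝓝 (s t))) :
    Tendsto (fun k => ∑ i ∈ Finset.range (P k).n,
      (((P k).pts (i + 1) - (P k).pts i) * κ ((P k).pts i)) • y k i) atTop
      (𝓝 (∫ t in Icc a b, κ t • s t)) := by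
  have hsum : ∀ k, ∑ i ∈ Finset.range (P k).n,
      (((P k).pts (i + 1) - (P k).pts i) * κ ((P k).pts i)) • y k i =
      ∫ t in Icc a b, κ ((P k).pts ((P k).idx t)) • y k ((P k).idx t) := fun k => by
    rw [(P k).integral_comp_idx fun i => κ ((P k).pts i) • y k i]
    simp only [mul_smul]
  simp only [hsum]
  have hbd : ∀ t ∈ Icc a b, |κ t| ≤ |κ a| + (eVariationOn κ (Icc a b)).toReal := fun t ht => by
    have h := hκ.dist_le ht (left_mem_Icc.2 (ht.1.trans ht.2))
    rw [Real.dist_eq] at h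
    linarith [abs_sub_abs_le_abs_sub (κ t) (κ a)]
  refine tendsto_integral_of_dominated_convergence
    (fun _ => (|κ a| + (eVariationOn κ (Icc a b)).toReal) * supNorm a b F)
    (fun k => ((P k).stronglyMeasurable_comp_idx
      fun i => κ ((P k).pts i) • y k i).aestronglyMeasurable)
    (integrable_const _) (fun k => Eventually.of_forall fun t => ?_) ?_
  · rw [norm_smul, Real.norm_eq_abs]
    have h1 := hbd _ ((P k).pts_idx_mem t)
    exact mul_le_mul h1 ((hy k).norm_chainFun_le hF t) (norm_nonneg _) ((abs_nonneg _).trans h1)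
  · rw [ae_restrict_iff' measurableSet_Icc]
    filter_upwards [ae_continuousWithinAt_of_boundedVariationOn hκ] with t ht htm
    refine Tendsto.smul ?_ (hs t htm)
    exact (ht htm).tendsto.comp (tendsto_nhdsWithin_iff.2
      ⟨IntervalPartition.tendsto_pts_idx hP htm,
        Eventually.of_forall fun k => (P k).pts_idx_mem t⟩)

/-- The weighted metric integral consists of the weighted integrals of the metric selections. -/
theorem mem_weightedMetricIntegral_iff [ProperSpace E] (hF : ClassF a b F) (hab : a < b)
    (hκ : BoundedVariationOn κ (Icc a b)) {z : E} :
    z ∈ weightedMetricIntegral a b κ F ↔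
      ∃ s, IsMetricSelection a b F s ∧ z = ∫ t in Icc a b, κ t • s t := by
  constructor
  · rintro ⟨P, w, hP, hw, hz⟩
    have hn : ∀ k, 0 < (P k).n := fun k => Nat.pos_of_ne_zero fun h0 => by
      have h1 := (P k).first
      have h2 := (P k).last
      rw [h0] at h2
      exact hab.ne (h1.symm.trans h2)
    choose y hy hwy using hw
    choose y' hy' hyy using fun k => (hy k).exists_extend (A := fun i => F ((P k).pts i)) (hn k)
    obtain ⟨φ, s, hφ, hs, hlim⟩ := exists_subseq_tendsto_isMetricSelection hF hy' hP
    refine ⟨s, hs, tendsto_nhds_unique (hz.comp hφ.tendsto_atTop) ?_⟩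
    refine (tendsto_weightedSum hF hκ (fun k => hy' (φ k)) (hP.comp hφ.tendsto_atTop)
      hlim).congr fun k => ?_
    rw [Function.comp_apply, hwy]
    exact Finset.sum_congr rfl fun i hi => by rw [hyy _ _ (Finset.mem_range.1 hi)]
  · rintro ⟨s, ⟨-, P, y, hy, hP, hlim⟩, rfl⟩
    exact ⟨P, _, hP, fun k => ⟨y k, (hy k).of_le (Nat.le_succ _), rfl⟩,
      tendsto_weightedSum hF hκ hy hP hlim⟩

end

/-! ### One-sided limits and quasi-modulus of a monotone function on an interval. -/

section

variable {a b x : ℝ} {v : ℝ → ℝ}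

/-- `v` is controlled only on `[a, b]`; its constant extension is monotone on the whole line and
agrees with it near `x`. -/
theorem tendsto_leftLim_of_monotoneOn (hv : MonotoneOn v (Icc a b)) (hx : x ∈ Ioo a b) :
    Tendsto v (𝓝[<] x) (𝓝 (Function.leftLim v x)) := by
  have hab := (hx.1.trans hx.2).le
  have hw : Monotone (IccExtend hab ((Icc a b).domRestrict v)) :=
    Monotone.IccExtend hab fun s t hst => hv s.2 t.2 hst
  have h := (hw.tendsto_leftLim x).congr' (f₂ := v) (by
    filter_upwards [Ioo_mem_nhdsLT hx.1] with t ht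
    exact IccExtend_of_mem hab _ ⟨ht.1.le, (ht.2.trans hx.2).le⟩)
  rwa [leftLim_eq_of_tendsto h]

theorem tendsto_rightLim_of_monotoneOn (hv : MonotoneOn v (Icc a b)) (hx : x ∈ Ioo a b) :
    Tendsto v (𝓝[>] x) (𝓝 (Function.rightLim v x)) := by
  have hab := (hx.1.trans hx.2).le
  have hw : Monotone (IccExtend hab ((Icc a b).domRestrict v)) :=
    Monotone.IccExtend hab fun s t hst => hv s.2 t.2 hst
  have h := (hw.tendsto_rightLim x).congr' (f₂ := v) (by
    filter_upwards [Ioo_mem_nhdsGT hx.2] with t ht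
    exact IccExtend_of_mem hab _ ⟨(hx.1.trans ht.1).le, ht.2.le⟩)
  rwa [rightLim_eq_of_tendsto h]

theorem le_leftLim_of_monotoneOn (hv : MonotoneOn v (Icc a b)) (hx : x ∈ Ioo a b) {t : ℝ}
    (hat : a ≤ t) (htx : t < x) : v t ≤ Function.leftLim v x := by
  refine ge_of_tendsto (tendsto_leftLim_of_monotoneOn hv hx) ?_
  filter_upwards [Ioo_mem_nhdsLT htx] with r hr
  exact hv ⟨hat, (htx.trans hx.2).le⟩ ⟨hat.trans hr.1.le, (hr.2.trans hx.2).le⟩ hr.1.le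

theorem rightLim_le_of_monotoneOn (hv : MonotoneOn v (Icc a b)) (hx : x ∈ Ioo a b) {t : ℝ}
    (htb : t ≤ b) (hxt : x < t) : Function.rightLim v x ≤ v t := by
  refine le_of_tendsto (tendsto_rightLim_of_monotoneOn hv hx) ?_
  filter_upwards [Ioo_mem_nhdsGT hxt] with r hr
  exact hv ⟨(hx.1.trans hr.1).le, hr.2.le.trans htb⟩ ⟨(hx.1.trans hxt).le, htb⟩ hr.2.le

theorem quasiModulus_nonneg {η : ℝ} : 0 ≤ quasiModulus a b v x η := by
  refine le_max_of_le_left (Real.sSup_nonneg ?_)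
  rintro _ ⟨t, -, rfl⟩
  exact dist_nonneg

theorem leftLim_sub_le_quasiModulus (hv : MonotoneOn v (Icc a b)) (hx : x ∈ Ioo a b) {t η : ℝ}
    (hat : a ≤ t) (ht : t ∈ Ico (x - η) x) :
    Function.leftLim v x - v t ≤ quasiModulus a b v x η := by
  refine le_max_of_le_left ((le_abs_self _).trans (le_csSup ⟨Function.leftLim v x - v a, ?_⟩
    ⟨t, ⟨ht, hat, (ht.2.trans hx.2).le⟩, Real.dist_eq _ _⟩))
  rintro _ ⟨r, ⟨hr, hrm⟩, rfl⟩
  have h1 := le_leftLim_of_monotoneOn hv hx hrm.1 hr.2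
  have h2 := hv (left_mem_Icc.2 (hx.1.trans hx.2).le) hrm hrm.1
  change dist (Function.leftLim v x) (v r) ≤ _
  rw [Real.dist_eq, abs_of_nonneg (sub_nonneg.2 h1)]
  linarith

theorem sub_rightLim_le_quasiModulus (hv : MonotoneOn v (Icc a b)) (hx : x ∈ Ioo a b) {t η : ℝ}
    (htb : t ≤ b) (ht : t ∈ Ioc x (x + η)) :
    v t - Function.rightLim v x ≤ quasiModulus a b v x η := by
  refine le_max_of_le_right ((le_abs_self _).trans (le_csSup ⟨v b - Function.rightLim v x, ?_⟩
    ⟨t, ⟨ht, (hx.1.trans ht.1).le, htb⟩, (dist_comm _ _).trans (Real.dist_eq _ _)⟩))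
  rintro _ ⟨r, ⟨hr, hrm⟩, rfl⟩
  have h1 := rightLim_le_of_monotoneOn hv hx hrm.2 hr.1
  have h2 := hv hrm (right_mem_Icc.2 (hx.1.trans hx.2).le) hrm.2
  change dist (Function.rightLim v x) (v r) ≤ _
  rw [dist_comm, Real.dist_eq, abs_of_nonneg (sub_nonneg.2 h1)]
  linarith

theorem tendsto_quasiModulus (hv : MonotoneOn v (Icc a b)) (hx : x ∈ Ioo a b) :
    Tendsto (fun η => quasiModulus a b v x η) (𝓝[>] 0) (𝓝 0) := by
  refine Metric.tendsto_nhds.2 fun ε hε => ?_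
  obtain ⟨l, hl, hl'⟩ := (mem_nhdsLT_iff_exists_Ioo_subset).1
    ((Metric.tendsto_nhds.1 (tendsto_leftLim_of_monotoneOn hv hx)) (ε / 2) (half_pos hε))
  obtain ⟨r, hr, hr'⟩ := (mem_nhdsGT_iff_exists_Ioo_subset).1
    ((Metric.tendsto_nhds.1 (tendsto_rightLim_of_monotoneOn hv hx)) (ε / 2) (half_pos hε))
  filter_upwards [Ioo_mem_nhdsGT (lt_min (sub_pos.2 hl) (sub_pos.2 hr))] with η hη
  have h1 := hη.2.trans_le (min_le_left _ _)
  have h2 := hη.2.trans_le (min_le_right _ _)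
  rw [Real.dist_eq, sub_zero, abs_of_nonneg quasiModulus_nonneg]
  refine (max_le (Real.sSup_le ?_ (half_pos hε).le) (Real.sSup_le ?_ (half_pos hε).le)).trans_lt
    (half_lt_self hε)
  · rintro _ ⟨t, ⟨ht, -⟩, rfl⟩
    have := hl' ⟨by linarith [ht.1], ht.2⟩
    exact (dist_comm _ _).trans_le (le_of_lt this)
  · rintro _ ⟨t, ⟨ht, -⟩, rfl⟩
    have := hr' ⟨ht.1, by linarith [ht.2]⟩
    exact (dist_comm _ _).trans_le (le_of_lt this)

end

/-! ### One-sided limits of metric selections and the error bound for one selection. -/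

section

variable {E : Type*} [NormedAddCommGroup E] {a b x : ℝ}
  {F : ℝ → TopologicalSpace.NonemptyCompacts E} {s : ℝ → E}

theorem IsMetricSelection.tendsto_leftLim [CompleteSpace E] (hF : BoundedVariationOn F (Icc a b))
    (hs : IsMetricSelection a b F s) (hx : x ∈ Ioo a b) :
    Tendsto s (𝓝[<] x) (𝓝 (Function.leftLim s x)) := by
  have hv := variationFun_monotoneOn hF
  suffices h : ∃ l, Tendsto s (𝓝[<] x) (𝓝 l) by
    obtain ⟨l, hl⟩ := h
    rwa [leftLim_eq_of_tendsto hl]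
  refine cauchy_map_iff_exists_tendsto.1 (Metric.cauchy_iff.2 ⟨inferInstance, fun ε hε => ?_⟩)
  obtain ⟨r, hr1, hr⟩ := (((Metric.tendsto_nhds.1 (tendsto_leftLim_of_monotoneOn hv hx)) ε hε).and
    (Ioo_mem_nhdsLT hx.1)).exists
  rw [Real.dist_eq, abs_lt] at hr1
  have key : ∀ t ∈ Ioo r x, ∀ t' ∈ Ioo r x, t ≤ t' → dist (s t) (s t') < ε := by
    intro t ht t' ht' htt
    have h1 := hs.dist_le hF hr.1.le (Or.inl ht.1)
      ⟨(hr.1.trans ht.1).le, (ht.2.trans hx.2).le⟩ htt (ht'.2.trans hx.2).le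
    have h2 := le_leftLim_of_monotoneOn hv hx (hr.1.trans ht'.1).le ht'.2
    linarith
  refine ⟨s '' Ioo r x, image_mem_map (Ioo_mem_nhdsLT hr.2), ?_⟩
  rintro _ ⟨t, ht, rfl⟩ _ ⟨t', ht', rfl⟩
  rcases le_total t t' with h | h
  · exact key t ht t' ht' h
  · exact dist_comm (s t) _ ▸ key t' ht' t ht h

theorem IsMetricSelection.tendsto_rightLim [CompleteSpace E] (hF : BoundedVariationOn F (Icc a b))
    (hs : IsMetricSelection a b F s) (hx : x ∈ Ioo a b) :
    Tendsto s (𝓝[>] x) (𝓝 (Function.rightLim s x)) := by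
  have hv := variationFun_monotoneOn hF
  suffices h : ∃ l, Tendsto s (𝓝[>] x) (𝓝 l) by
    obtain ⟨l, hl⟩ := h
    rwa [rightLim_eq_of_tendsto hl]
  refine cauchy_map_iff_exists_tendsto.1 (Metric.cauchy_iff.2 ⟨inferInstance, fun ε hε => ?_⟩)
  obtain ⟨r, hr1, hr⟩ := (((Metric.tendsto_nhds.1 (tendsto_rightLim_of_monotoneOn hv hx)) ε hε).and
    (Ioo_mem_nhdsGT hx.2)).exists
  rw [Real.dist_eq, abs_lt] at hr1
  have key : ∀ t ∈ Ioo x r, ∀ t' ∈ Ioo x r, t ≤ t' → dist (s t) (s t') < ε := by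
    intro t ht t' ht' htt
    -- The slack point stays to the right of `x`, so that `v_F(q) ≥ v_F(x+)` and a jump of `v_F` at
    -- `x` does not enter.
    obtain ⟨q, hq1, hq2⟩ := exists_between ht.1
    have h1 := hs.dist_le hF (hx.1.trans hq1).le (Or.inl hq2)
      ⟨(hx.1.trans ht.1).le, (ht.2.trans hr.2).le⟩ htt (ht'.2.trans hr.2).le
    have h2 := rightLim_le_of_monotoneOn hv hx ((hq2.trans ht.2).trans hr.2).le hq1
    have h3 := hv ⟨(hx.1.trans ht'.1).le, (ht'.2.trans hr.2).le⟩ ⟨(hx.1.trans hr.1).le, hr.2.le⟩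
      ht'.2.le
    linarith
  refine ⟨s '' Ioo x r, image_mem_map (Ioo_mem_nhdsGT hr.1), ?_⟩
  rintro _ ⟨t, ht, rfl⟩ _ ⟨t', ht', rfl⟩
  rcases le_total t t' with h | h
  · exact key t ht t' ht' h
  · exact dist_comm (s t) _ ▸ key t' ht' t ht h

/-- The radius doubles because the bound on `s` needs a base point strictly left of `t`, and `t` may
equal `x - δ`; the point `x - 2δ`, cut off at `a`, serves for all `t`. -/
theorem IsMetricSelection.dist_leftLim_le [CompleteSpace E] (hF : BoundedVariationOn F (Icc a b))
    (hs : IsMetricSelection a b F s) (hx : x ∈ Ioo a b) {δ t : ℝ} (hδ : 0 < δ) (hat : a ≤ t)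
    (ht : t ∈ Ico (x - δ) x) :
    dist (s t) (Function.leftLim s x) ≤ quasiModulus a b (variationFun a F) x (2 * δ) := by
  have hv := variationFun_monotoneOn hF
  refine le_of_tendsto (tendsto_const_nhds.dist (hs.tendsto_leftLim hF hx)) ?_
  filter_upwards [Ioo_mem_nhdsLT ht.2] with t' ht'
  have hr : max a (x - 2 * δ) < t ∨ max a (x - 2 * δ) = a := by
    rcases hat.lt_or_eq with h | h
    · exact Or.inl (max_lt h (by linarith [ht.1]))
    · exact Or.inr (max_eq_left (by linarith [ht.1]))
  have h1 := hs.dist_le hF (le_max_left _ _) hr ⟨hat, (ht.2.trans hx.2).le⟩ ht'.1.le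
    (ht'.2.trans hx.2).le
  have h2 := le_leftLim_of_monotoneOn hv hx (hat.trans ht'.1.le) ht'.2
  have h3 := leftLim_sub_le_quasiModulus hv hx (η := 2 * δ) (le_max_left _ _)
    ⟨le_max_right _ _, max_lt hx.1 (by linarith)⟩
  linarith

/-- Here the base point fits between `x` and `t'`, so radius `δ` would suffice; `2 * δ` matches the
left-hand bound. -/
theorem IsMetricSelection.dist_rightLim_le [CompleteSpace E] (hF : BoundedVariationOn F (Icc a b))
    (hs : IsMetricSelection a b F s) (hx : x ∈ Ioo a b) {δ t : ℝ} (hδ : 0 < δ) (htb : t ≤ b)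
    (ht : t ∈ Ioc x (x + δ)) :
    dist (s t) (Function.rightLim s x) ≤ quasiModulus a b (variationFun a F) x (2 * δ) := by
  have hv := variationFun_monotoneOn hF
  refine le_of_tendsto (tendsto_const_nhds.dist (hs.tendsto_rightLim hF hx)) ?_
  filter_upwards [Ioo_mem_nhdsGT ht.1] with t' ht'
  obtain ⟨r, hr1, hr2⟩ := exists_between ht'.1
  have h1 := hs.dist_le hF (hx.1.trans hr1).le (Or.inl hr2)
    ⟨(hx.1.trans ht'.1).le, ht'.2.le.trans htb⟩ ht'.2.le htb
  have h2 := rightLim_le_of_monotoneOn hv hx ((hr2.trans ht'.2).le.trans htb) hr1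
  have h3 := sub_rightLim_le_quasiModulus hv hx (η := 2 * δ) htb ⟨ht.1, by linarith [ht.2]⟩
  rw [dist_comm]
  linarith

theorem IsMetricSelection.norm_leftLim_le [CompleteSpace E] (hF : ClassF a b F)
    (hs : IsMetricSelection a b F s) (hx : x ∈ Ioo a b) :
    ‖Function.leftLim s x‖ ≤ supNorm a b F := by
  refine le_of_tendsto (hs.tendsto_leftLim hF.1 hx).norm ?_
  filter_upwards [Ioo_mem_nhdsLT hx.1] with t ht
  exact hs.norm_le hF ⟨ht.1.le, (ht.2.trans hx.2).le⟩

theorem IsMetricSelection.norm_rightLim_le [CompleteSpace E] (hF : ClassF a b F)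
    (hs : IsMetricSelection a b F s) (hx : x ∈ Ioo a b) :
    ‖Function.rightLim s x‖ ≤ supNorm a b F := by
  refine le_of_tendsto (hs.tendsto_rightLim hF.1 hx).norm ?_
  filter_upwards [Ioo_mem_nhdsGT hx.2] with t ht
  exact hs.norm_le hF ⟨(hx.1.trans ht.1).le, ht.2.le⟩

/-- The error of a kernel average of a metric selection against the midpoint of its one-sided
limits. -/
theorem IsMetricSelection.norm_integral_sub_midpoint_le [NormedSpace ℝ E] [CompleteSpace E]
    (hF : ClassF a b F) (hs : IsMetricSelection a b F s) (hx : x ∈ Ioo a b) {κ : ℝ → ℝ}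
    (hκ : IntegrableOn κ (Icc a b)) {δ : ℝ} (hδ : 0 < δ) :
    ‖(∫ t in Icc a b, κ t • s t) -
        (1 / 2 : ℝ) • (Function.rightLim s x + Function.leftLim s x)‖ ≤
      quasiModulus a b (variationFun a F) x (2 * δ) * (∫ t in Icc a b, |κ t|) +
        supNorm a b F * (2 * (∫ t in Icc a b ∩ {t | δ ≤ |x - t|}, |κ t|) +
          |(∫ t in Icc a b, κ t) - 1| + |∫ t in Icc a b, κ t * Real.sign (t - x)|) := by
  set L := Function.leftLim s x with hL
  set R := Function.rightLim s x with hR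
  set N := supNorm a b F with hN
  set Q := quasiModulus a b (variationFun a F) x (2 * δ) with hQ
  have hLN : ‖L‖ ≤ N := hs.norm_leftLim_le hF hx
  have hRN : ‖R‖ ≤ N := hs.norm_rightLim_le hF hx
  set m : E := (1 / 2 : ℝ) • (R + L) with hm
  set h : E := (1 / 2 : ℝ) • (R - L) with hh
  have hmN : ‖m‖ ≤ N := by
    rw [hm, norm_smul, Real.norm_of_nonneg (by norm_num)]
    linarith [norm_add_le R L]
  have hhN : ‖h‖ ≤ N := by
    rw [hh, norm_smul, Real.norm_of_nonneg (by norm_num)]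
    linarith [norm_sub_le R L]
  have hQ0 : 0 ≤ Q := quasiModulus_nonneg
  have hsign : Measurable fun t => Real.sign (t - x) := by
    have : Measurable Real.sign := by
      unfold Real.sign
      exact Measurable.ite measurableSet_Iio measurable_const
        (Measurable.ite measurableSet_Ioi measurable_const measurable_const)
    exact this.comp (measurable_id.sub_const x)
  have hsignle : ∀ t, |Real.sign (t - x)| ≤ 1 := fun t => by
    rcases Real.sign_apply_eq (t - x) with h | h | h <;> simp [h]
  have i1 : IntegrableOn (fun t => κ t • s t) (Icc a b) := by
    refine (hκ.norm.mul_const N).mono' (hκ.aestronglyMeasurable.smul hs.aestronglyMeasurable) ?_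
    refine (ae_restrict_iff' measurableSet_Icc).2 (Eventually.of_forall fun t ht => ?_)
    rw [norm_smul]
    exact mul_le_mul_of_nonneg_left (hs.norm_le hF ht) (norm_nonneg _)
  have i2 : IntegrableOn (fun t => κ t * Real.sign (t - x)) (Icc a b) := by
    refine hκ.norm.mono' (hκ.aestronglyMeasurable.mul hsign.aestronglyMeasurable)
      (Eventually.of_forall fun t => ?_)
    rw [norm_mul]
    exact mul_le_of_le_one_right (norm_nonneg _) (hsignle t)
  have i3 : IntegrableOn (fun t => κ t • m) (Icc a b) := hκ.smul_const m
  have i4 : IntegrableOn (fun t => (κ t * Real.sign (t - x)) • h) (Icc a b) := i2.smul_const h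
  have hsplit : (∫ t in Icc a b, κ t • s t) - m =
      (∫ t in Icc a b, (κ t • s t - κ t • m - (κ t * Real.sign (t - x)) • h)) +
        ((∫ t in Icc a b, κ t) - 1) • m +
        (∫ t in Icc a b, κ t * Real.sign (t - x)) • h := by
    have e1 := integral_sub (i1.sub i3) i4
    have e2 := integral_sub i1 i3
    simp only [Pi.sub_apply] at e1 e2
    rw [e1, e2, integral_smul_const, integral_smul_const, sub_smul, one_smul]
    abel
  have hTm : MeasurableSet {t : ℝ | δ ≤ |x - t|} :=
    measurableSet_le measurable_const (by fun_prop)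
  have hbound : ‖∫ t in Icc a b, (κ t • s t - κ t • m - (κ t * Real.sign (t - x)) • h)‖ ≤
      ∫ t in Icc a b, (Q * |κ t| + 2 * N * {t | δ ≤ |x - t|}.indicator (fun t => |κ t|) t) := by
    refine norm_integral_le_of_norm_le
      ((hκ.norm.const_mul Q).add ((hκ.norm.indicator hTm).const_mul (2 * N))) ?_
    rw [ae_restrict_iff' measurableSet_Icc]
    -- The point `t = x` is discarded: `s x` need not be near either one-sided limit.
    filter_upwards [Measure.ae_ne volume x] with t htx ht
    have hfac : ∀ g : E, m + Real.sign (t - x) • h = g →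
        ‖κ t • s t - κ t • m - (κ t * Real.sign (t - x)) • h‖ = |κ t| * dist (s t) g := by
      rintro g rfl
      rw [dist_eq_norm, ← Real.norm_eq_abs, ← norm_smul, smul_sub, smul_add, mul_smul, sub_sub]
    have hfin : ∀ g : E, ‖g‖ ≤ N → (|x - t| < δ → dist (s t) g ≤ Q) →
        |κ t| * dist (s t) g ≤
          Q * |κ t| + 2 * N * {t | δ ≤ |x - t|}.indicator (fun t => |κ t|) t := by
      intro g hg hnear
      by_cases hd : δ ≤ |x - t|
      · rw [indicator_of_mem (show t ∈ {t | δ ≤ |x - t|} from hd)]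
        have h1 : dist (s t) g ≤ 2 * N := by
          linarith [dist_le_norm_add_norm (s t) g, hs.norm_le hF ht]
        nlinarith [mul_le_mul_of_nonneg_left h1 (abs_nonneg (κ t)), mul_nonneg hQ0 (abs_nonneg (κ t))]
      · rw [indicator_of_notMem (show t ∉ {t | δ ≤ |x - t|} from hd)]
        nlinarith [mul_le_mul_of_nonneg_left (hnear (not_le.1 hd)) (abs_nonneg (κ t))]
    rcases lt_or_gt_of_ne htx with hlt | hgt
    · rw [hfac L (by
        rw [Real.sign_of_neg (sub_neg.2 hlt), hm, hh]
        module)]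
      refine hfin L hLN fun hd => hs.dist_leftLim_le hF.1 hx hδ ht.1 ⟨?_, hlt⟩
      linarith [(abs_lt.1 hd).2]
    · rw [hfac R (by
        rw [Real.sign_of_pos (sub_pos.2 hgt), hm, hh]
        module)]
      refine hfin R hRN fun hd => hs.dist_rightLim_le hF.1 hx hδ ht.2 ⟨hgt, ?_⟩
      linarith [(abs_lt.1 hd).1]
  have hκ' : IntegrableOn (fun t => |κ t|) (Icc a b) := hκ.norm
  have e3 : ∫ t in Icc a b, (Q * |κ t| + 2 * N * {t | δ ≤ |x - t|}.indicator (fun t => |κ t|) t) =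
      Q * (∫ t in Icc a b, |κ t|) + 2 * N * ∫ t in Icc a b ∩ {t | δ ≤ |x - t|}, |κ t| := by
    rw [integral_add (hκ'.const_mul Q) ((hκ'.indicator hTm).const_mul (2 * N)),
      integral_const_mul, integral_const_mul, setIntegral_indicator hTm]
  rw [e3] at hbound
  rw [hsplit]
  refine (norm_add₃_le).trans ?_
  rw [norm_smul _ m, norm_smul _ h, Real.norm_eq_abs, Real.norm_eq_abs]
  have h1 := mul_le_mul_of_nonneg_left hmN (abs_nonneg ((∫ t in Icc a b, κ t) - 1))
  have h2 := mul_le_mul_of_nonneg_left hhN (abs_nonneg (∫ t in Icc a b, κ t * Real.sign (t - x)))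
  linarith

end

end MetricSVF

/-! ### The error estimate and convergence. -/

theorem mainTheorem2
    {E : Type*} [NormedAddCommGroup E] [NormedSpace ℝ E] [FiniteDimensional ℝ E]
    (a b : ℝ) (F : ℝ → TopologicalSpace.NonemptyCompacts E) (hF : MetricSVF.ClassF a b F)
    (K : ℕ → ℝ → ℝ → ℝ)
    (hK : ∀ n, ∀ z ∈ Icc a b, BoundedVariationOn (fun t => K n z t) (Icc a b))
    (M : ℝ → ℝ≥0∞)
    (hM : ∀ z ∈ Icc a b, ∀ n, ENNReal.ofReal (∫ t in Icc a b, |K n z t|) ≤ M z)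
    (x : ℝ) (hx : x ∈ Ioo a b) :
    -- the sets whose Hausdorff distance is measured are non-empty
    (∀ n, (MetricSVF.metricIntegralOp a b K F n x).Nonempty) ∧
    (MetricSVF.midpointSet a b F x).Nonempty ∧
    -- the error estimate
    (∀ δ : ℝ, 0 < δ → ∀ n,
      Metric.hausdorffEDist (MetricSVF.metricIntegralOp a b K F n x)
          (MetricSVF.midpointSet a b F x) ≤
        2 * ENNReal.ofReal
            (MetricSVF.quasiModulus a b (MetricSVF.variationFun a F) x (2 * δ)) * M x +
          ENNReal.ofReal (MetricSVF.supNorm a b F *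
            (4 * MetricSVF.beta a b K n x δ + MetricSVF.alpha a b K n x +
              |MetricSVF.integralOp a b K n (fun t => Real.sign (t - x)) x|))) ∧
    -- convergence
    (Tendsto (fun n => MetricSVF.alpha a b K n x) atTop (𝓝 0) →
      (∀ᶠ δ in 𝓝[>] (0 : ℝ), Tendsto (fun n => MetricSVF.beta a b K n x δ) atTop (𝓝 0)) →
      Tendsto (fun n => MetricSVF.integralOp a b K n (fun t => Real.sign (t - x)) x)
        atTop (𝓝 0) →
      M x < ∞ →
      Tendsto (fun n => Metric.hausdorffEDist (MetricSVF.metricIntegralOp a b K F n x)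
        (MetricSVF.midpointSet a b F x)) atTop (𝓝 0)) := by
  have hab : a < b := hx.1.trans hx.2
  have hxm : x ∈ Icc a b := ⟨hx.1.le, hx.2.le⟩
  have hmem : ∀ n z, z ∈ MetricSVF.metricIntegralOp a b K F n x ↔
      ∃ s, MetricSVF.IsMetricSelection a b F s ∧ z = ∫ t in Icc a b, K n x t • s t := fun n z =>
    MetricSVF.mem_weightedMetricIntegral_iff hF hab (hK n x hxm)
  obtain ⟨s₀, hs₀⟩ := MetricSVF.exists_isMetricSelection hF hab
  have hN : 0 ≤ MetricSVF.supNorm a b F :=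
    (norm_nonneg _).trans (hs₀.norm_le hF hxm)
  have hβ : ∀ n δ, 0 ≤ MetricSVF.beta a b K n x δ := fun n δ =>
    integral_nonneg fun t => abs_nonneg _
  have hmain : ∀ δ : ℝ, 0 < δ → ∀ n,
      Metric.hausdorffEDist (MetricSVF.metricIntegralOp a b K F n x)
          (MetricSVF.midpointSet a b F x) ≤
        2 * ENNReal.ofReal
            (MetricSVF.quasiModulus a b (MetricSVF.variationFun a F) x (2 * δ)) * M x +
          ENNReal.ofReal (MetricSVF.supNorm a b F *
            (4 * MetricSVF.beta a b K n x δ + MetricSVF.alpha a b K n x +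
              |MetricSVF.integralOp a b K n (fun t => Real.sign (t - x)) x|)) := by
    intro δ hδ n
    have key : ∀ s, MetricSVF.IsMetricSelection a b F s →
        edist (∫ t in Icc a b, K n x t • s t)
          ((1 / 2 : ℝ) • (Function.rightLim s x + Function.leftLim s x)) ≤
        2 * ENNReal.ofReal
            (MetricSVF.quasiModulus a b (MetricSVF.variationFun a F) x (2 * δ)) * M x +
          ENNReal.ofReal (MetricSVF.supNorm a b F *
            (4 * MetricSVF.beta a b K n x δ + MetricSVF.alpha a b K n x +
              |MetricSVF.integralOp a b K n (fun t => Real.sign (t - x)) x|)) := by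
      intro s hs
      rw [edist_dist, dist_eq_norm]
      refine (ENNReal.ofReal_le_ofReal (hs.norm_integral_sub_midpoint_le hF hx
        (MetricSVF.integrableOn_of_boundedVariationOn (hK n x hxm)) hδ)).trans
        (ENNReal.ofReal_add_le.trans (add_le_add ?_ (ENNReal.ofReal_le_ofReal ?_)))
      · rw [ENNReal.ofReal_mul MetricSVF.quasiModulus_nonneg]
        refine mul_le_mul' ?_ (hM x hxm n)
        -- The bound for one selection carries factor `1` on the quasi-modulus and `2` on `β`; the
        -- stated `2` and `4` are weaker.
        exact le_mul_of_one_le_left' one_le_two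
      · refine mul_le_mul_of_nonneg_left ?_ hN
        have := hβ n δ
        simp only [MetricSVF.beta, MetricSVF.alpha, MetricSVF.integralOp] at this ⊢
        linarith
    refine Metric.hausdorffEDist_le_of_mem_edist (fun z hz => ?_) fun z hz => ?_
    · obtain ⟨s, hs, rfl⟩ := (hmem n z).1 hz
      exact ⟨_, ⟨s, hs, rfl⟩, key s hs⟩
    · obtain ⟨s, hs, rfl⟩ := hz
      exact ⟨_, (hmem n _).2 ⟨s, hs, rfl⟩, edist_comm (α := E) _ _ ▸ key s hs⟩
  refine ⟨fun n => ⟨_, (hmem n _).2 ⟨s₀, hs₀, rfl⟩⟩, ⟨_, s₀, hs₀, rfl⟩, hmain, ?_⟩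
  intro hα hβ0 hsign hMx
  refine ENNReal.tendsto_nhds_zero.2 fun ε hε => ?_
  have hε2 : 0 < ε / 2 := ENNReal.half_pos hε.ne'
  have hΩ : Tendsto (fun δ : ℝ => 2 * ENNReal.ofReal
      (MetricSVF.quasiModulus a b (MetricSVF.variationFun a F) x (2 * δ)) * M x)
      (𝓝[>] 0) (𝓝 0) := by
    have h1 : Tendsto (fun δ : ℝ => 2 * δ) (𝓝[>] 0) (𝓝[>] 0) := by
      refine tendsto_nhdsWithin_iff.2 ⟨tendsto_nhdsWithin_of_tendsto_nhds ?_, ?_⟩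
      · simpa using (continuous_const_mul (2 : ℝ)).tendsto 0
      · filter_upwards [self_mem_nhdsWithin] with δ hδ
        exact mul_pos two_pos (mem_Ioi.1 hδ)
    have h2 := ENNReal.tendsto_ofReal ((MetricSVF.tendsto_quasiModulus
      (MetricSVF.variationFun_monotoneOn hF.1) hx).comp h1)
    have h3 := ENNReal.Tendsto.mul_const (b := M x) (ENNReal.Tendsto.const_mul (a := 2) h2
      (Or.inr ENNReal.ofNat_ne_top)) (Or.inr hMx.ne)
    simpa using h3
  -- First `δ` is fixed to make the quasi-modulus term small uniformly in `n`, which uses `M x < ∞`;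
  -- only then does `n` tend to infinity.
  obtain ⟨δ, ⟨hδΩ, hδβ⟩, hδ⟩ :=
    (((ENNReal.tendsto_nhds_zero.1 hΩ _ hε2).and hβ0).and self_mem_nhdsWithin).exists
  have hrest : Tendsto (fun n => ENNReal.ofReal (MetricSVF.supNorm a b F *
      (4 * MetricSVF.beta a b K n x δ + MetricSVF.alpha a b K n x +
        |MetricSVF.integralOp a b K n (fun t => Real.sign (t - x)) x|))) atTop (𝓝 0) := by
    have h1 := ENNReal.tendsto_ofReal
      ((((hδβ.const_mul 4).add hα).add hsign.abs).const_mul (MetricSVF.supNorm a b F))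
    simpa using h1
  filter_upwards [ENNReal.tendsto_nhds_zero.1 hrest _ hε2] with n hn
  exact (hmain δ hδ n).trans ((add_le_add hδΩ hn).trans_eq (ENNReal.add_halves ε))
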